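/- Let $M$ be a finite set of $m$ candidates. A ranking is a bijection $\pi:[m]\to M$; a profile $\boldsymbol{\pi}=(\pi_1,\dots,\pi_n)$ consists of $n\ge 1$ rankings; $\Pi_n$ is the set of profiles of size $n$ and $\Pi=\bigcup_{n\ge1}\Pi_n$. A voting rule is a map $R:\Pi\to 2^M$. Fix one ranking $\pi_{-1}$; the histogram $\mathbf{h}^{\boldsymbol{\pi}}\in\mathbb{R}^{m!-1}$ has, for each ranking $\pi\neq\pi_{-1}$, the coordinate $\frac1n|\{i:\pi_i=\pi\}|$. Finitely many affine hyperplanes $H_1,\dots,H_\ell$ of $\mathbb{R}^{m!-1}$ partition the space of histograms into regions, according to whether a point lies on, or on which side of, each $H_j$. $R$ is a hyperplane rule (with hyperplanes $H_1,\dots,H_\ell$) if $R(\boldsymbol{\pi})=R(\boldsymbol{\pi}')$ whenever $\mathbf{h}^{\boldsymbol{\pi}}$ and $\mathbf{h}^{\boldsymbol{\pi}'}$ lie in the same region. It is decisive if $|R(\boldsymbol{\pi})|=1$ for every profile $\boldsymbol{\pi}$ whose histogram lies on none of the $H_j$, and non-decisive otherwise. A noise model $\mathcal{S}$ assigns to each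 $\phi\in[0,1]$ a probability distribution $\mathcal{S}_\phi$ on the permutations of $[m]$ such that: $\mathcal{S}_0$ is the point mass at the identity and $\mathcal{S}_1$ is uniform; $\min_\sigma\Pr[\mathcal{S}_\phi=\sigma]$ is positive for $\phi\in(0,1]$ and non-decreasing in $\phi$; and $\Pr[\mathcal{S}_\phi=\sigma]$ is continuous in $\phi$ for each $\sigma$. For a profile $\boldsymbol{\pi}$ of size $n$, $\mathcal{S}_\phi(\boldsymbol{\pi})$ is the random profile $(\pi_1\circ\sigma_1,\dots,\pi_n\circ\sigma_n)$ with $\sigma_1,\dots,\sigma_n$ drawn independently from $\mathcal{S}_\phi$. For $z\ge1$, $z\boldsymbol{\pi}$ is the concatenation of $z$ copies of $\boldsymbol{\pi}$. A voting rule $R$ satisfies Resolvability on $\boldsymbol{\pi}$ if $|R(\boldsymbol{\pi})|=1$. $R$ smoothed-satisfies Resolvability (under $\mathcal{S}$) if there is $f(n,\phi)$ with $f(n,\phi)\to0$ as $n\to\infty$ for each fixed $\phi\in(0,1]$, such that for all $n\ge1$ and $\phi\in(0,1]$ $$\sup_{\phi'\in[\phi,1]}\ \sup_{\boldsymbol{\pi}\in\Pi_n}\Pr\big[|R(\mathcal{S}_{\phi'}(\boldsymbol{\pi}))|\neq1\big]\le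 f(n,\phi).$$ $R$ smoothed-violates Resolvability (under $\mathcal{S}$) if there are $f(n)$ with $f(n)\to0$ as $n\to\infty$, a $\phi\in(0,1]$ and a profile $\boldsymbol{\pi}$, of size $n$ say, such that for all integers $z\ge1$ $$\inf_{\phi'\in[0,\phi]}\Pr\big[|R(\mathcal{S}_{\phi'}(z\boldsymbol{\pi}))|\neq1\big]\ge1-f(zn).$$ **Proposition.** For every noise model $\mathcal{S}$: every decisive hyperplane rule smoothed-satisfies Resolvability, and every non-decisive hyperplane rule smoothed-violates Resolvability. -/

import Mathlib

open MeasureTheory Filter Asymptotics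

noncomputable section

namespace SmoothedVoting

universe u

/-- A ranking of the finite candidate set `M` (with `m = |M|`): a bijection `[m] → M`, where
`r j` is the candidate in position `j`. -/
abbrev Ranking (M : Type u) [Fintype M] : Type u := Fin (Fintype.card M) ≃ M

/-- The finite set of rankings carries the discrete σ-algebra. -/
instance (M : Type u) [Fintype M] : MeasurableSpace (Ranking M) := ⊤

/-- A profile: a positive number of voters together with a ranking for each voter. -/
structure Profile (M : Type u) [Fintype M] where
  size : ℕ+
  vote : Fin size → Ranking M

/-- The profile `z π`, i.e. `π` concatenated with itself `z` times: voter `i` of `z π` votes like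
voter `i mod n` of `π`, where `n` is the size of `π`. -/
def Profile.copies {M : Type u} [Fintype M] (z : ℕ+) (p : Profile M) : Profile M where
  size := z * p.size
  vote := fun i => p.vote ⟨(i : ℕ) % p.size, Nat.mod_lt _ p.size.pos⟩

/-- A criterion is a predicate on profiles. -/
abbrev Criterion (M : Type u) [Fintype M] : Type u := Profile M → Prop

/-- A voting rule maps each profile to a set of winning candidates. -/
abbrev VotingRule (M : Type u) [Fintype M] : Type u := Profile M → Finset M

/-- Resolvability of `R`: on the given profile there is exactly one winner. -/
def Resolvability {M : Type u} [Fintype M] (R : VotingRule M) : Criterion M :=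
  fun p => (R p).card = 1

/-! ### Histograms and hyperplane rules -/

/-- The histogram of a profile. The coordinates are all rankings except the fixed ranking `last`;
the coordinate of `r` is the proportion of voters whose ranking is `r`. -/
def histogram {M : Type u} [Fintype M] [DecidableEq M] (last : Ranking M) (p : Profile M) :
    {r : Ranking M // r ≠ last} → ℝ :=
  fun r => ((Finset.univ.filter fun i : Fin p.size => p.vote i = r.1).card : ℝ) / (p.size : ℕ)

/-- An affine hyperplane `{x | ∑ i, normal i * x i = offset}` of `ℝ^ι`. -/
structure AffineHyperplane (ι : Type u) where
  normal : ι → ℝ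
  offset : ℝ
  normal_ne_zero : normal ≠ 0

/-- The position of a point with respect to a hyperplane: `0` if it lies on the hyperplane, and
`1` or `-1` according to the open side on which it lies. -/
def AffineHyperplane.side {ι : Type u} [Fintype ι] (G : AffineHyperplane ι) (x : ι → ℝ) :
    SignType :=
  SignType.sign (∑ i, G.normal i * x i - G.offset)

/-- `R` is a hyperplane rule with respect to the hyperplanes `G 0, …, G (ℓ - 1)`: it is constant on
each of the regions into which they partition the space of histograms. -/
def IsHyperplaneRule {M : Type u} [Fintype M] [DecidableEq M] (last : Ranking M) {ℓ : ℕ}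
    (G : Fin ℓ → AffineHyperplane {r : Ranking M // r ≠ last}) (R : VotingRule M) : Prop :=
  ∀ p q : Profile M,
    (∀ j, (G j).side (histogram last p) = (G j).side (histogram last q)) → R p = R q

/-- `R` is decisive with respect to the hyperplanes `G`: it outputs a single winner on every profile
whose histogram lies on none of them. -/
def IsDecisive {M : Type u} [Fintype M] [DecidableEq M] (last : Ranking M) {ℓ : ℕ}
    (G : Fin ℓ → AffineHyperplane {r : Ranking M // r ≠ last}) (R : VotingRule M) : Prop :=
  ∀ p : Profile M, (∀ j, (G j).side (histogram last p) ≠ 0) → (R p).card = 1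

/-! ### Noise models -/

/-- The smallest probability that a distribution over permutations assigns to a permutation. -/
def minProb {m : ℕ} (μ : PMF (Equiv.Perm (Fin m))) : ENNReal := ⨅ σ, μ σ

/-- A noise model: for each `φ ∈ [0, 1]` a distribution over the permutations of the `m` positions,
which is the point mass on the identity at `φ = 0` and uniform at `φ = 1`, gives positive
probability to every permutation when `φ > 0`, has nondecreasing minimum probability, and depends
continuously on `φ`. -/
structure NoiseModel (m : ℕ) where
  dist : unitInterval → PMF (Equiv.Perm (Fin m))
  dist_zero : dist 0 = PMF.pure 1
  dist_one : dist 1 = PMF.uniformOfFintype (Equiv.Perm (Fin m))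
  minProb_pos : ∀ φ, 0 < φ → 0 < minProb (dist φ)
  minProb_mono : Monotone fun φ => minProb (dist φ)
  continuous_prob : ∀ σ, Continuous fun φ => dist φ σ

/-- Noise applied to one ranking: the law of `r ∘ σ` with `σ` drawn from `S_φ`. The candidate in
position `i` after the noise is the one that was in position `σ i` before. -/
def NoiseModel.rankingLaw {M : Type u} [Fintype M] (S : NoiseModel (Fintype.card M))
    (φ : unitInterval) (r : Ranking M) : PMF (Ranking M) :=
  (S.dist φ).map fun σ => σ.trans r

/-- Noise applied to a profile: the voters' rankings are perturbed independently. -/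
def NoiseModel.profileLaw {M : Type u} [Fintype M] (S : NoiseModel (Fintype.card M))
    (φ : unitInterval) (p : Profile M) : Measure (Fin p.size → Ranking M) :=
  Measure.pi fun i => (S.rankingLaw φ (p.vote i)).toMeasure

/-- The probability that the perturbed profile is a counterexample to the criterion `C`. -/
def NoiseModel.probViolation {M : Type u} [Fintype M] (S : NoiseModel (Fintype.card M))
    (φ : unitInterval) (p : Profile M) (C : Criterion M) : ℝ :=
  (S.profileLaw φ p).real {v | ¬ C ⟨p.size, v⟩}

/-! ### Smoothed satisfaction and smoothed violation -/

/-- `C` is `S`-smoothed-satisfied at rate `f`: for all `n ≥ 1` and `φ ∈ (0, 1]`, the supremum over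
`φ' ∈ [φ, 1]` and over profiles of size `n` of the violation probability is at most `f n φ`. -/
def SmoothedSatisfiedAtRate {M : Type u} [Fintype M] (S : NoiseModel (Fintype.card M))
    (C : Criterion M) (f : ℕ → unitInterval → ℝ) : Prop :=
  ∀ (n : ℕ+) (φ : unitInterval), 0 < φ →
    ∀ φ' ∈ Set.Icc φ 1, ∀ p : Profile M, p.size = n → S.probViolation φ' p C ≤ f n φ

/-- `C` is `S`-smoothed-satisfied: it is so at a rate which, for each fixed `φ ∈ (0, 1]`, is
subconstant. -/
def SmoothedSatisfied {M : Type u} [Fintype M] (S : NoiseModel (Fintype.card M))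
    (C : Criterion M) : Prop :=
  ∃ f : ℕ → unitInterval → ℝ,
    (∀ φ, 0 < φ → (fun n => f n φ) =o[atTop] fun _ => (1 : ℝ)) ∧ SmoothedSatisfiedAtRate S C f

/-- `C` is `S`-smoothed-violated at rate `f`: there are `φ ∈ (0, 1]` and a profile `p` of some size
`n` such that for all `z ≥ 1` the infimum over `φ' ∈ [0, φ]` of the violation probability at
the perturbed `z p` is at least `1 - f (z n)`. -/
def SmoothedViolatedAtRate {M : Type u} [Fintype M] (S : NoiseModel (Fintype.card M))
    (C : Criterion M) (f : ℕ → ℝ) : Prop :=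
  ∃ φ : unitInterval, 0 < φ ∧ ∃ p : Profile M, ∀ z : ℕ+, ∀ φ' ∈ Set.Icc 0 φ,
    1 - f (z * p.size) ≤ S.probViolation φ' (p.copies z) C

/-- `C` is `S`-smoothed-violated: it is so at a subconstant rate. -/
def SmoothedViolated {M : Type u} [Fintype M] (S : NoiseModel (Fintype.card M))
    (C : Criterion M) : Prop :=
  ∃ f : ℕ → ℝ, f =o[atTop] (fun _ => (1 : ℝ)) ∧ SmoothedViolatedAtRate S C f

end SmoothedVoting

end

/-! Give each ranking its coefficient in the equation of a hyperplane as a score, with score 0 for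
the omitted ranking. A histogram then lies on the hyperplane exactly when the average score of the
voters equals the offset, so both halves concern sums of independent bounded terms.

Decisive case: a failure forces the histogram onto one of finitely many hyperplanes, so it suffices
that a sum of scores hits a given value with vanishing probability, uniformly over profiles. Every
voter takes each ranking with probability at least some ε > 0, and two rankings `s`, `t` have
different scores. Switching one voter from `s` to `t` translates the sum by `a t - a s`; averaging
over the voter shows that this translation lowers point probabilities by at most O(1/√(εn))
(`pi_real_sum_eq_le_shift`). Translating repeatedly yields K disjoint events, each nearly as likely
as the original one, which bounds its probability by 1/K + O(K/√(εn)) (`pi_real_sum_eq_le`); K is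
taken near n^(1/4).

Non-decisive case: some profile off all hyperplanes does not have exactly one winner. By continuity,
small noise barely moves the mean scores, and Chebyshev's inequality (`pi_real_abs_sum_sub_ge_le`)
keeps the noisy histogram of its copies in the same region, hence with the same winners, with
probability 1 - O(1/n). -/

/-! ### Anticoncentration and concentration under product measures -/

section ProductMeasure

variable {α ι : Type*} [Finite α] [MeasurableSpace α] [DiscreteMeasurableSpace α]
  [Fintype ι] (ν : ι → Measure α) [∀ i, IsProbabilityMeasure (ν i)]

/-- Under a product measure, the value of one coordinate is independent of the sum over the
other ones. -/
theorem pi_real_coord_inter_sum [DecidableEq ι] (a : α → ℝ) (s : α) (i : ι) (x : ℝ) :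
    (Measure.pi ν).real ({v | v i = s} ∩ {v | ∑ j, a (v j) = x}) =
      (ν i).real {s} *
        (Measure.pi ν).real {v | ∑ j with j ≠ i, a (v j) = x - a s} := by
  have hind : ProbabilityTheory.iIndepFun (fun (j : ι) (v : ι → α) => v j) (Measure.pi ν) :=
    ProbabilityTheory.iIndepFun_pi (X := fun _ => id) fun _ => aemeasurable_id
  have h := (hind.indepFun_finset {i} (Finset.univ.filter (· ≠ i)) (by simp)
    fun j => measurable_pi_apply j).comp
      (φ := fun w => w ⟨i, by simp⟩)
      (ψ := fun w => ∑ j : (Finset.univ.filter (· ≠ i) : Finset ι), a (w j))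
      (Measurable.of_discrete) (Measurable.of_discrete)
  have h2 := h.measure_inter_preimage_eq_mul {s} {x - a s} .of_discrete
    (measurableSet_singleton _)
  have hsum : ∀ v : ι → α, ∑ j : (Finset.univ.filter (· ≠ i) : Finset ι), a (v j) =
      ∑ j with j ≠ i, a (v j) := fun v =>
    Finset.sum_coe_sort (Finset.univ.filter (· ≠ i)) fun j => a (v j)
  have hcoord : (Measure.pi ν) {v | v i = s} = ν i {s} := by
    rw [← (measurePreserving_eval ν i).measure_preimage (MeasurableSet.of_discrete.nullMeasurableSet)]
    rfl
  have hset : ({v | v i = s} ∩ {v | ∑ j, a (v j) = x} : Set (ι → α)) =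
      {v | v i = s} ∩ {v | ∑ j with j ≠ i, a (v j) = x - a s} := by
    ext v
    simp only [Set.mem_inter_iff, Set.mem_ofPred_eq, and_congr_right_iff]
    intro hv
    rw [Finset.filter_ne', ← Finset.add_sum_erase _ _ (Finset.mem_univ i), hv]
    constructor <;> intro h <;> linarith
  rw [hset, measureReal_def, measureReal_def, measureReal_def, ← ENNReal.toReal_mul, ← hcoord]
  congr 1
  have hpre : (fun v : ι → α => ∑ j : (Finset.univ.filter (· ≠ i) : Finset ι), a (v j)) ⁻¹'
      {x - a s} = {v | ∑ j with j ≠ i, a (v j) = x - a s} := by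
    ext v
    rw [Set.mem_preimage, hsum]
    rfl
  rw [← hpre]
  exact h2

/-- The centred, normalized number of coordinates equal to `s` has second moment at most `n / ε`. -/
theorem integral_sq_normalized_count_le {ε : ℝ} (hε : 0 < ε) (s : α)
    (hs : ∀ i, ε ≤ (ν i).real {s}) :
    ∫ v, (∑ i, (Set.indicator {s} (fun _ => ((ν i).real {s})⁻¹) (v i) - 1)) ^ 2 ∂Measure.pi ν ≤
      Fintype.card ι / ε := by
  classical
  have hmean : ∀ i, ∫ y, (Set.indicator {s} (fun _ => ((ν i).real {s})⁻¹) y - 1) ∂ν i = 0 := by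
    intro i
    have hi : (ν i).real {s} ≠ 0 := (hε.trans_le (hs i)).ne'
    rw [integral_sub .of_finite .of_finite, integral_indicator_const _ .of_discrete]
    rw [smul_eq_mul, mul_inv_cancel₀ hi]
    simp
  have hvar := ProbabilityTheory.variance_sum_pi (μ := ν)
    (X := fun i y => Set.indicator {s} (fun _ => ((ν i).real {s})⁻¹) y - 1)
    (fun i => MemLp.of_discrete)
  rw [ProbabilityTheory.variance_eq_integral (Measurable.of_discrete.aemeasurable)] at hvar
  have hzero : ∫ v, (∑ i, fun (v : ι → α) =>
      Set.indicator {s} (fun _ => ((ν i).real {s})⁻¹) (v i) - 1) v ∂Measure.pi ν = 0 := by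
    simp only [Finset.sum_apply]
    rw [integral_finsetSum _ fun i _ => .of_finite]
    refine Finset.sum_eq_zero fun i _ => ?_
    rw [← hmean i]
    exact integral_comp_eval (μ := ν) (f := fun y =>
      Set.indicator {s} (fun _ => ((ν i).real {s})⁻¹) y - 1)
      Measurable.of_discrete.aestronglyMeasurable
  rw [hzero] at hvar
  simp only [Finset.sum_apply, sub_zero] at hvar
  rw [hvar]
  have hterm : ∀ i, ProbabilityTheory.variance
      (fun y => Set.indicator {s} (fun _ => ((ν i).real {s})⁻¹) y - 1) (ν i) ≤ ε⁻¹ := by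
    intro i
    have hi : 0 < (ν i).real {s} := hε.trans_le (hs i)
    rw [ProbabilityTheory.variance_sub_const Measurable.of_discrete.aestronglyMeasurable]
    refine (ProbabilityTheory.variance_le_expectation_sq
      Measurable.of_discrete.aestronglyMeasurable).trans ?_
    have : ((fun y => Set.indicator {s} (fun _ => ((ν i).real {s})⁻¹) y) ^ 2 : α → ℝ) =
        Set.indicator {s} (fun _ => ((ν i).real {s})⁻¹ ^ 2) := by
      ext y
      by_cases h : y = s <;> simp [h]
    rw [this, integral_indicator .of_discrete]
    simp only [integral_const, measureReal_restrict_apply_univ, smul_eq_mul]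
    calc (ν i).real {s} * ((ν i).real {s})⁻¹ ^ 2 = ((ν i).real {s})⁻¹ := by field_simp
      _ ≤ ε⁻¹ := inv_anti₀ hε (hs i)
  calc _ ≤ ∑ _i : ι, ε⁻¹ := Finset.sum_le_sum fun i _ => hterm i
    _ = _ := by simp [div_eq_mul_inv]

/-- The average of the conditional probabilities of an event `A` given `v i = s` approximates the
probability of `A`. -/
theorem abs_sum_cond_sub_le {ε : ℝ} (hε : 0 < ε) (s : α) (hs : ∀ i, ε ≤ (ν i).real {s})
    [Nonempty ι] (A : Set (ι → α)) :
    |∑ i, ((ν i).real {s})⁻¹ * (Measure.pi ν).real ({v | v i = s} ∩ A) -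
      Fintype.card ι * (Measure.pi ν).real A| ≤ √(Fintype.card ι / ε) := by
  classical
  -- The integral of `D` over `A` is exactly the difference to be bounded, so a second moment bound
  -- on `D` suffices.
  set D : (ι → α) → ℝ :=
    fun v => ∑ i, (Set.indicator {s} (fun _ => ((ν i).real {s})⁻¹) (v i) - 1) with hD
  set c := √(Fintype.card ι / ε)
  have hc : 0 < c := Real.sqrt_pos.2 (by positivity)
  have hc2 : c ^ 2 = Fintype.card ι / ε := Real.sq_sqrt (by positivity)
  have hD2 : ∫ v, D v ^ 2 ∂Measure.pi ν ≤ c ^ 2 :=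
    hc2 ▸ integral_sq_normalized_count_le ν hε s hs
  have key : ∑ i, ((ν i).real {s})⁻¹ * (Measure.pi ν).real ({v | v i = s} ∩ A) -
      Fintype.card ι * (Measure.pi ν).real A = ∫ v, A.indicator D v ∂Measure.pi ν := by
    rw [integral_indicator .of_discrete, hD, integral_finsetSum _ fun i _ => .of_finite]
    have : ∀ i, ∫ v in A, (Set.indicator {s} (fun _ => ((ν i).real {s})⁻¹) (v i) - 1)
        ∂Measure.pi ν = ((ν i).real {s})⁻¹ * (Measure.pi ν).real ({v | v i = s} ∩ A) -
          (Measure.pi ν).real A := by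
      intro i
      rw [integral_sub .of_finite .of_finite]
      have h1 : (fun v : ι → α => Set.indicator {s} (fun _ => ((ν i).real {s})⁻¹) (v i)) =
          Set.indicator {v | v i = s} (fun _ => ((ν i).real {s})⁻¹) := by
        ext v
        by_cases h : v i = s <;> simp [h]
      rw [h1, integral_indicator .of_discrete, Measure.restrict_restrict .of_discrete]
      simp [mul_comm]
    rw [Finset.sum_congr rfl fun i _ => this i, Finset.sum_sub_distrib]
    simp
  rw [key]
  refine (abs_integral_le_integral_abs).trans ?_
  -- The pointwise bound |D| ≤ (D² + c²) / (2c) plays the role of Cauchy–Schwarz.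
  calc ∫ v, |A.indicator D v| ∂Measure.pi ν ≤ ∫ v, (D v ^ 2 + c ^ 2) / (2 * c) ∂Measure.pi ν := by
        refine integral_mono .of_finite .of_finite fun v => ?_
        have h1 : |A.indicator D v| ≤ |D v| := by
          by_cases h : v ∈ A <;> simp [h]
        refine h1.trans ?_
        rw [le_div_iff₀ (by positivity)]
        nlinarith [sq_nonneg (|D v| - c), sq_abs (D v)]
    _ = (∫ v, D v ^ 2 ∂Measure.pi ν + c ^ 2) / (2 * c) := by
        rw [integral_div, integral_add .of_finite .of_finite]
        simp
    _ ≤ c := by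
        rw [div_le_iff₀ (by positivity)]
        nlinarith

/-- The law of a sum of independent terms is nearly invariant under the translation by the
difference of two values that each term takes with probability at least `ε`. -/
theorem pi_real_sum_eq_le_shift {ε : ℝ} (hε : 0 < ε) [Nonempty ι] (a : α → ℝ) (s t : α)
    (hs : ∀ i, ε ≤ (ν i).real {s}) (ht : ∀ i, ε ≤ (ν i).real {t}) (x : ℝ) :
    (Measure.pi ν).real {v | ∑ i, a (v i) = x} ≤
      (Measure.pi ν).real {v | ∑ i, a (v i) = x + (a t - a s)} +
        2 / √(ε * Fintype.card ι) := by
  classical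
  have h1 := abs_le.1 (abs_sum_cond_sub_le ν hε s hs {v | ∑ i, a (v i) = x})
  have h2 := abs_le.1 (abs_sum_cond_sub_le ν hε t ht {v | ∑ i, a (v i) = x + (a t - a s)})
  -- Given either value of coordinate `i`, the event says that the other coordinates sum to `x - a
  -- s`, so the two conditional probabilities agree.
  have heq : ∀ i, ((ν i).real {s})⁻¹ *
      (Measure.pi ν).real ({v | v i = s} ∩ {v | ∑ i, a (v i) = x}) =
      ((ν i).real {t})⁻¹ *
      (Measure.pi ν).real ({v | v i = t} ∩ {v | ∑ i, a (v i) = x + (a t - a s)}) := by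
    intro i
    have hi : (ν i).real {s} ≠ 0 := (hε.trans_le (hs i)).ne'
    have hi' : (ν i).real {t} ≠ 0 := (hε.trans_le (ht i)).ne'
    rw [pi_real_coord_inter_sum, pi_real_coord_inter_sum, inv_mul_cancel_left₀ hi,
      inv_mul_cancel_left₀ hi', show x + (a t - a s) - a t = x - a s by ring]
  simp_rw [heq] at h1
  have hn : (0 : ℝ) < Fintype.card ι := by exact_mod_cast Fintype.card_pos
  have hsq : √(Fintype.card ι / ε) = Fintype.card ι * (1 / √(ε * Fintype.card ι)) := by
    rw [Real.sqrt_div hn.le, Real.sqrt_mul hε.le]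
    have := Real.sq_sqrt hn.le
    have := Real.sqrt_pos.2 hn
    have := Real.sqrt_pos.2 hε
    field_simp
    linarith
  rw [hsq] at h1 h2
  have : Fintype.card ι * (Measure.pi ν).real {v | ∑ i, a (v i) = x} ≤
      Fintype.card ι * ((Measure.pi ν).real {v | ∑ i, a (v i) = x + (a t - a s)} +
        2 / √(ε * Fintype.card ι)) := by
    have : (2 : ℝ) / √(ε * Fintype.card ι) = 2 * (1 / √(ε * Fintype.card ι)) := by ring
    rw [this]
    linarith [h1.1, h2.2]
  exact le_of_mul_le_mul_left this hn

/-- Anticoncentration for a sum of independent terms, each of which takes two distinct values with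
probability at least `ε`. -/
theorem pi_real_sum_eq_le {ε : ℝ} (hε : 0 < ε) [Nonempty ι] (a : α → ℝ) (s t : α)
    (hst : a s ≠ a t) (hs : ∀ i, ε ≤ (ν i).real {s}) (ht : ∀ i, ε ≤ (ν i).real {t}) (x : ℝ)
    (K : ℕ) (hK : 0 < K) :
    (Measure.pi ν).real {v | ∑ i, a (v i) = x} ≤
      1 / K + K * (2 / √(ε * Fintype.card ι)) := by
  set δ := 2 / √(ε * Fintype.card ι)
  have hδ : 0 ≤ δ := by positivity
  have hiter : ∀ k : ℕ, (Measure.pi ν).real {v | ∑ i, a (v i) = x} ≤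
      (Measure.pi ν).real {v | ∑ i, a (v i) = x + k * (a t - a s)} + k * δ := by
    intro k
    induction k with
    | zero => simp
    | succ k ih =>
      have := pi_real_sum_eq_le_shift ν hε a s t hs ht (x + k * (a t - a s))
      rw [show x + k * (a t - a s) + (a t - a s) = x + ((k + 1 : ℕ) : ℝ) * (a t - a s) by
        push_cast; ring] at this
      push_cast at this ⊢
      linarith
  -- The translates are pairwise distinct because `a s ≠ a t`, so the events are disjoint.
  have hdisj : ∑ k ∈ Finset.range K,
      (Measure.pi ν).real {v | ∑ i, a (v i) = x + k * (a t - a s)} ≤ 1 := by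
    rw [← measureReal_biUnion_finset _ fun _ _ => .of_discrete]
    · exact measureReal_le_one
    · intro k _ l _ hkl
      refine Set.disjoint_left.2 fun v hv hv' => hkl ?_
      simp only [Set.mem_ofPred_eq] at hv hv'
      have h : (k : ℝ) * (a t - a s) = l * (a t - a s) := by linarith
      exact_mod_cast mul_right_cancel₀ (sub_ne_zero.2 hst.symm) h
  have hsum : K * (Measure.pi ν).real {v | ∑ i, a (v i) = x} ≤ 1 + K * (K * δ) := by
    calc K * (Measure.pi ν).real {v | ∑ i, a (v i) = x}
        = ∑ _k ∈ Finset.range K, (Measure.pi ν).real {v | ∑ i, a (v i) = x} := by simp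
      _ ≤ ∑ k ∈ Finset.range K,
          ((Measure.pi ν).real {v | ∑ i, a (v i) = x + k * (a t - a s)} + K * δ) := by
          refine Finset.sum_le_sum fun k hk => (hiter k).trans ?_
          have : (k : ℝ) ≤ K := by exact_mod_cast (Finset.mem_range.1 hk).le
          gcongr
      _ ≤ 1 + K * (K * δ) := by
          rw [Finset.sum_add_distrib]
          simpa using hdisj
  have hK' : (0 : ℝ) < K := by exact_mod_cast hK
  refine le_of_mul_le_mul_left (hsum.trans_eq ?_) hK'
  field_simp

/-- Weak law of large numbers for a bounded function of the coordinates. -/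
theorem pi_real_abs_sum_sub_ge_le (a : α → ℝ) {C η : ℝ} (hη : 0 < η) (hC : ∀ y, |a y| ≤ C)
    [Nonempty ι] :
    (Measure.pi ν).real
      {v | Fintype.card ι * η ≤ |∑ i, a (v i) - ∑ i, ∫ y, a y ∂ν i|} ≤
      C ^ 2 / η ^ 2 / Fintype.card ι := by
  have hn : (0 : ℝ) < Fintype.card ι := by exact_mod_cast Fintype.card_pos
  have hmean : ∫ v, ∑ i, a (v i) ∂Measure.pi ν = ∑ i, ∫ y, a y ∂ν i := by
    rw [integral_finsetSum _ fun i _ => .of_finite]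
    exact Finset.sum_congr rfl fun i _ => integral_comp_eval (μ := ν)
      Measurable.of_discrete.aestronglyMeasurable
  have hvar := ProbabilityTheory.variance_sum_pi (μ := ν) (X := fun _ => a)
    (fun i => MemLp.of_discrete)
  have hfun : (∑ i, fun v : ι → α => a (v i)) = fun v => ∑ i, a (v i) := by
    ext v; simp
  rw [hfun] at hvar
  have hvar' : ProbabilityTheory.variance (fun v : ι → α => ∑ i, a (v i)) (Measure.pi ν) ≤
      Fintype.card ι * C ^ 2 := by
    rw [hvar]
    calc _ ≤ ∑ _i : ι, C ^ 2 := by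
          refine Finset.sum_le_sum fun i _ => ?_
          refine (ProbabilityTheory.variance_le_sq_of_bounded (a := -C) (b := C)
            (.of_forall fun y => abs_le.1 (hC y))
            Measurable.of_discrete.aemeasurable).trans_eq ?_
          ring
      _ = _ := by simp
  have hch := ProbabilityTheory.meas_ge_le_variance_div_sq (μ := Measure.pi ν)
    (X := fun v : ι → α => ∑ i, a (v i)) MemLp.of_discrete (mul_pos hn hη)
  rw [hmean] at hch
  refine (ENNReal.toReal_le_of_le_ofReal (div_nonneg (ProbabilityTheory.variance_nonneg _ _)
    (sq_nonneg _)) hch).trans ?_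
  calc _ ≤ Fintype.card ι * C ^ 2 / (Fintype.card ι * η) ^ 2 := by gcongr
    _ = _ := by field_simp

end ProductMeasure

/-! ### Profiles, and hyperplanes as conditions on average scores -/

namespace SmoothedVoting

variable {M : Type*} [Fintype M]

instance : DiscreteMeasurableSpace (Ranking M) := ⟨fun _ => trivial⟩

theorem Profile.nonempty_voters (p : Profile M) : Nonempty (Fin p.size) := ⟨⟨0, p.size.pos⟩⟩

theorem Profile.sum_copies (z : ℕ+) (p : Profile M) (a : Ranking M → ℝ) :
    ∑ i, a ((p.copies z).vote i) = (z : ℕ) * ∑ i, a (p.vote i) := by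
  have h : ∀ x : Fin z × Fin p.size,
      a ((p.copies z).vote (finProdFinEquiv x)) = a (p.vote x.2) := by
    intro x
    have : (p.copies z).vote (finProdFinEquiv x) = p.vote x.2 := by
      simp only [Profile.copies]
      congr 1
      ext
      change ((x.2 : ℕ) + p.size * x.1) % p.size = x.2
      rw [Nat.add_mul_mod_self_left, Nat.mod_eq_of_lt x.2.isLt]
    rw [this]
  have h2 := Equiv.sum_comp (finProdFinEquiv (m := z) (n := p.size))
    fun i => a ((p.copies z).vote i)
  refine h2.symm.trans ((Finset.sum_congr rfl fun x _ => h x).trans ?_)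
  rw [Fintype.sum_prod_type]
  simp

section Histogram

variable [DecidableEq M] {last : Ranking M}

/-- The coefficient of a ranking in the linear functional defining a hyperplane; the ranking that
is not a coordinate of the histogram has coefficient `0`. -/
noncomputable def AffineHyperplane.score (G : AffineHyperplane {r : Ranking M // r ≠ last})
    (r : Ranking M) : ℝ :=
  if h : r = last then 0 else G.normal ⟨r, h⟩

theorem AffineHyperplane.score_last (G : AffineHyperplane {r : Ranking M // r ≠ last}) :
    G.score last = 0 := by
  simp [score]

/-- Together with `score_last` this supplies the two rankings of different score that
anticoncentration needs. -/
theorem AffineHyperplane.exists_score_ne_zero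
    (G : AffineHyperplane {r : Ranking M // r ≠ last}) : ∃ r, G.score r ≠ 0 := by
  obtain ⟨r, hr⟩ := Function.ne_iff.1 G.normal_ne_zero
  exact ⟨r.1, by simpa [score, r.2] using hr⟩

theorem AffineHyperplane.sum_normal_mul_histogram
    (G : AffineHyperplane {r : Ranking M // r ≠ last}) (p : Profile M) :
    ∑ r, G.normal r * histogram last p r = (∑ i, G.score (p.vote i)) / (p.size : ℕ) := by
  have hscore : ∀ s : Ranking M,
      G.score s = ∑ r : {r : Ranking M // r ≠ last}, if s = r.1 then G.normal r else 0 := by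
    intro s
    by_cases h : s = last
    · subst h
      rw [G.score_last]
      exact (Finset.sum_eq_zero fun r _ => if_neg (Ne.symm r.2)).symm
    · rw [Finset.sum_eq_single ⟨s, h⟩]
      · simp [score, h]
      · intro r _ hr
        exact if_neg fun hs => hr (Subtype.ext hs.symm)
      · simp
  simp_rw [hscore]
  rw [Finset.sum_comm, Finset.sum_div]
  refine Finset.sum_congr rfl fun r _ => ?_
  rw [histogram, ← Finset.sum_filter, Finset.sum_const, nsmul_eq_mul]
  ring

theorem AffineHyperplane.side_histogram (G : AffineHyperplane {r : Ranking M // r ≠ last})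
    (p : Profile M) : G.side (histogram last p) =
      SignType.sign ((∑ i, G.score (p.vote i)) / (p.size : ℕ) - G.offset) := by
  rw [side, G.sum_normal_mul_histogram]

end Histogram

/-! ### Probabilities and mean scores under the noise -/

namespace NoiseModel

variable (S : NoiseModel (Fintype.card M))

theorem rankingLaw_apply (φ : unitInterval) (r s : Ranking M) :
    S.rankingLaw φ r s = S.dist φ (s.trans r.symm) := by
  have h : s = (s.trans r.symm).trans r := by ext; simp
  rw [rankingLaw, PMF.map_apply, tsum_eq_single (s.trans r.symm)]
  · rw [if_pos h]
  · intro σ hσ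
    refine if_neg fun hs => hσ ?_
    rw [hs]
    ext; simp

theorem rankingLaw_real_singleton (φ : unitInterval) (r s : Ranking M) :
    (S.rankingLaw φ r).toMeasure.real {s} = (S.dist φ (s.trans r.symm)).toReal := by
  rw [measureReal_def, PMF.toMeasure_apply_singleton _ _ .of_discrete, rankingLaw_apply]

theorem minProb_toReal_pos {φ : unitInterval} (hφ : 0 < φ) : 0 < (minProb (S.dist φ)).toReal :=
  ENNReal.toReal_pos (S.minProb_pos φ hφ).ne'
    (((iInf_le _ 1).trans (PMF.coe_le_one _ _)).trans_lt ENNReal.one_lt_top).ne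

theorem minProb_toReal_le_rankingLaw {φ φ' : unitInterval} (h : φ ≤ φ') (r s : Ranking M) :
    (minProb (S.dist φ)).toReal ≤ (S.rankingLaw φ' r).toMeasure.real {s} := by
  rw [rankingLaw_real_singleton]
  exact ENNReal.toReal_mono (PMF.apply_ne_top _ _) ((S.minProb_mono h).trans (iInf_le _ _))

theorem integral_rankingLaw [DecidableEq M] (φ : unitInterval) (r : Ranking M) (a : Ranking M → ℝ) :
    ∫ s, a s ∂(S.rankingLaw φ r).toMeasure =
      ∑ s : Ranking M, (S.dist φ (s.trans r.symm)).toReal * a s := by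
  rw [integral_fintype .of_finite]
  simp_rw [rankingLaw_real_singleton, smul_eq_mul]

/-- The mean is a finite sum of probabilities continuous in the noise level, and the law at level 0
is the point mass at `r`. -/
theorem tendsto_integral_rankingLaw (r : Ranking M) (a : Ranking M → ℝ) :
    Tendsto (fun φ => ∫ s, a s ∂(S.rankingLaw φ r).toMeasure) (nhds 0) (nhds (a r)) := by
  have hcont : Continuous fun φ => ∫ s, a s ∂(S.rankingLaw φ r).toMeasure := by
    classical
    simp_rw [integral_rankingLaw]
    refine continuous_finsetSum _ fun s _ => Continuous.mul ?_ continuous_const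
    exact ENNReal.continuousOn_toReal.comp_continuous (S.continuous_prob _)
      fun φ => PMF.apply_ne_top _ _
  have h0 : ∫ s, a s ∂(S.rankingLaw 0 r).toMeasure = a r := by
    rw [rankingLaw, S.dist_zero, PMF.pure_map, PMF.toMeasure_pure, integral_dirac]
    rfl
  rw [← h0]
  exact hcont.tendsto 0

end NoiseModel

/-! ### Decisive rules: hitting a hyperplane is unlikely -/

section Resolvability

variable [DecidableEq M] {last : Ranking M}

theorem NoiseModel.profileLaw_side_eq_zero_le (S : NoiseModel (Fintype.card M))
    (G : AffineHyperplane {r : Ranking M // r ≠ last}) {φ φ' : unitInterval} (hφ : 0 < φ)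
    (h : φ ≤ φ') (p : Profile M) :
    (S.profileLaw φ' p).real {v | G.side (histogram last ⟨p.size, v⟩) = 0} ≤
      (1 + 4 / √(minProb (S.dist φ)).toReal) / √√(p.size : ℕ) := by
  have := p.nonempty_voters
  obtain ⟨s, hs⟩ := G.exists_score_ne_zero
  set ε := (minProb (S.dist φ)).toReal
  have hε : 0 < ε := S.minProb_toReal_pos hφ
  have hn : (1 : ℝ) ≤ (p.size : ℕ) := by exact_mod_cast p.size.pos
  -- With K = ⌈n^(1/4)⌉ the terms 1/K and K/√n are both of order n^(-1/4); `1 ≤ t` gives K ≤ 2t.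
  set t := √√((p.size : ℕ) : ℝ) with ht
  have ht1 : 1 ≤ t := by rw [ht, Real.one_le_sqrt, Real.one_le_sqrt]; exact hn
  have ht2 : t ^ 2 = √((p.size : ℕ) : ℝ) := Real.sq_sqrt (Real.sqrt_nonneg _)
  have hset : {v | G.side (histogram last ⟨p.size, v⟩) = 0} =
      {v : Fin p.size → Ranking M | ∑ i, G.score (v i) = (p.size : ℕ) * G.offset} := by
    ext v
    rw [Set.mem_ofPred_eq, Set.mem_ofPred_eq, G.side_histogram, sign_eq_zero_iff, sub_eq_zero,
      div_eq_iff (by positivity), mul_comm]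
  have key := pi_real_sum_eq_le (fun i => (S.rankingLaw φ' (p.vote i)).toMeasure) hε G.score s last
    (by rwa [G.score_last]) (fun i => S.minProb_toReal_le_rankingLaw h _ _)
    (fun i => S.minProb_toReal_le_rankingLaw h _ _) ((p.size : ℕ) * G.offset) ⌈t⌉₊
    (Nat.ceil_pos.2 (by linarith))
  rw [hset]
  refine key.trans ?_
  rw [Fintype.card_fin, Real.sqrt_mul hε.le, ← ht2]
  have hK := Nat.le_ceil t
  have hK' := (Nat.ceil_lt_add_one (by linarith : 0 ≤ t)).le
  have hsε : 0 < √ε := Real.sqrt_pos.2 hε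
  calc (1 : ℝ) / ⌈t⌉₊ + ⌈t⌉₊ * (2 / (√ε * t ^ 2)) ≤ 1 / t + (2 * t) * (2 / (√ε * t ^ 2)) := by
        gcongr
        linarith
    _ = (1 + 4 / √ε) / t := by
        field_simp
        ring

theorem smoothedSatisfied_resolvability (S : NoiseModel (Fintype.card M)) {R : VotingRule M}
    {ℓ : ℕ} {G : Fin ℓ → AffineHyperplane {r : Ranking M // r ≠ last}}
    (hR : IsDecisive last G R) : SmoothedSatisfied S (Resolvability R) := by
  refine ⟨fun n φ => ℓ * ((1 + 4 / √(minProb (S.dist φ)).toReal) / √√(n : ℝ)), fun φ _ => ?_,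
    fun n φ hφ φ' hφ' p hp => ?_⟩
  · rw [isLittleO_one_iff]
    have h : Tendsto (fun n : ℕ => √√(n : ℝ)) atTop atTop :=
      Real.tendsto_sqrt_atTop.comp (Real.tendsto_sqrt_atTop.comp tendsto_natCast_atTop_atTop)
    simpa using (h.const_div_atTop (1 + 4 / √(minProb (S.dist φ)).toReal)).const_mul (ℓ : ℝ)
  · subst hp
    have hsub : {v | ¬ Resolvability R ⟨p.size, v⟩} ⊆
        ⋃ j, {v | (G j).side (histogram last ⟨p.size, v⟩) = 0} := by
      intro v hv
      by_contra hcon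
      simp only [Set.mem_iUnion, not_exists] at hcon
      exact hv (hR _ hcon)
    have : IsProbabilityMeasure (S.profileLaw φ' p) := by
      unfold NoiseModel.profileLaw; infer_instance
    calc S.probViolation φ' p (Resolvability R)
        ≤ (S.profileLaw φ' p).real
            (⋃ j, {v | (G j).side (histogram last ⟨p.size, v⟩) = 0}) := measureReal_mono hsub
      _ ≤ ∑ j, (S.profileLaw φ' p).real {v | (G j).side (histogram last ⟨p.size, v⟩) = 0} :=
          measureReal_iUnion_fintype_le _
      _ ≤ ∑ _j : Fin ℓ, (1 + 4 / √(minProb (S.dist φ)).toReal) / √√(p.size : ℕ) :=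
          Finset.sum_le_sum fun j _ => S.profileLaw_side_eq_zero_le (G j) hφ hφ'.1 p
      _ = _ := by simp

/-! ### Non-decisive rules: the noisy histogram stays in an open region -/

theorem sign_eq_of_abs_sub_lt {x y : ℝ} (h : |x - y| < |y|) :
    SignType.sign x = SignType.sign y := by
  rcases lt_trichotomy y 0 with hy | rfl | hy
  · rw [abs_of_neg hy] at h
    rw [sign_neg hy, sign_neg (by linarith [(abs_lt.1 h).2])]
  · simp [not_lt.2 (abs_nonneg x)] at h
  · rw [abs_of_pos hy] at h
    rw [sign_pos hy, sign_pos (by linarith [(abs_lt.1 h).1])]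

theorem AffineHyperplane.side_histogram_eq_of_abs_sub_lt
    (G : AffineHyperplane {r : Ranking M // r ≠ last}) (p q : Profile M) {η : ℝ}
    (hη : η < |(∑ i, G.score (p.vote i)) / (p.size : ℕ) - G.offset|)
    (h : |∑ i, G.score (q.vote i) - (q.size : ℕ) * ((∑ i, G.score (p.vote i)) / (p.size : ℕ))| <
      (q.size : ℕ) * η) : G.side (histogram last q) = G.side (histogram last p) := by
  have hn : (0 : ℝ) < (q.size : ℕ) := by exact_mod_cast q.size.pos
  rw [G.side_histogram, G.side_histogram]
  refine sign_eq_of_abs_sub_lt (lt_trans ?_ hη)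
  rw [sub_sub_sub_cancel_right, div_sub' hn.ne', abs_div, abs_of_pos hn, div_lt_iff₀' hn]
  exact h

theorem smoothedViolated_resolvability (S : NoiseModel (Fintype.card M)) {R : VotingRule M}
    {ℓ : ℕ} {G : Fin ℓ → AffineHyperplane {r : Ranking M // r ≠ last}}
    (hG : IsHyperplaneRule last G R) (hR : ¬ IsDecisive last G R) :
    SmoothedViolated S (Resolvability R) := by
  simp only [IsDecisive, not_forall] at hR
  obtain ⟨p, hp, hcard⟩ := hR
  have hy : ∀ j, 0 < |(∑ i, (G j).score (p.vote i)) / (p.size : ℕ) - (G j).offset| := by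
    intro j
    have := hp j
    rw [(G j).side_histogram] at this
    exact abs_pos.2 fun h => this (by rw [h, sign_zero])
  -- Half of the margin `2 * η` absorbs the shift of the mean caused by the noise, the other half
  -- the random fluctuation around that mean.
  obtain ⟨η, hη2, hη⟩ : ∃ η : ℝ, (∀ j,
      2 * η < |(∑ i, (G j).score (p.vote i)) / (p.size : ℕ) - (G j).offset|) ∧ 0 < η := by
    have h1 : ∀ᶠ η : ℝ in nhdsWithin 0 (Set.Ioi 0), ∀ j,
        2 * η < |(∑ i, (G j).score (p.vote i)) / (p.size : ℕ) - (G j).offset| := by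
      refine eventually_all.2 fun j => nhdsWithin_le_nhds ?_
      have : Tendsto (fun η : ℝ => 2 * η) (nhds 0) (nhds 0) := by
        simpa using (continuous_const_mul (2 : ℝ)).tendsto 0
      exact this.eventually_lt_const (hy j)
    exact (h1.and self_mem_nhdsWithin).exists
  have hev : ∀ᶠ φ : unitInterval in nhds 0, ∀ (j : Fin ℓ) (r : Ranking M),
      |∫ s, (G j).score s ∂(S.rankingLaw φ r).toMeasure - (G j).score r| < η :=
    eventually_all.2 fun j => eventually_all.2 fun r => by
      simpa [Real.dist_eq] using
        (Metric.tendsto_nhds.1 (S.tendsto_integral_rankingLaw r (G j).score)) η hη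
  obtain ⟨φ, hφ, hφη⟩ : ∃ φ : unitInterval, 0 < φ ∧ ∀ φ' ∈ Set.Icc 0 φ, ∀ (j : Fin ℓ)
      (r : Ranking M),
      |∫ s, (G j).score s ∂(S.rankingLaw φ' r).toMeasure - (G j).score r| < η := by
    obtain ⟨u, hu, hsub⟩ := exists_Ico_subset_of_mem_nhds hev ⟨1, zero_lt_one⟩
    obtain ⟨φ, hφ0, hφu⟩ := exists_between hu
    exact ⟨φ, hφ0, fun φ' hφ' => hsub ⟨hφ'.1, hφ'.2.trans_lt hφu⟩⟩
  obtain ⟨C, hC⟩ : ∃ C : ℝ, ∀ x : Fin ℓ × Ranking M, |(G x.1).score x.2| ≤ C := by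
    obtain ⟨C, hC⟩ := (Set.finite_range
      fun x : Fin ℓ × Ranking M => |(G x.1).score x.2|).bddAbove
    exact ⟨C, fun x => hC ⟨x, rfl⟩⟩
  -- The rate is Chebyshev's bound for one hyperplane, summed over all `ℓ` of them.
  refine ⟨fun n => ℓ * (C ^ 2 / η ^ 2 / n), ?_, φ, hφ, p, fun z φ' hφ' => ?_⟩
  · rw [isLittleO_one_iff]
    simpa using (tendsto_const_div_atTop_nhds_zero_nat (C ^ 2 / η ^ 2)).const_mul (ℓ : ℝ)
  set q := p.copies z with hq
  have := q.nonempty_voters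
  have hsize : ((q.size : ℕ) : ℝ) = (z : ℕ) * (p.size : ℕ) := by
    rw [hq, Profile.copies]
    push_cast
    rfl
  have hprob : IsProbabilityMeasure (S.profileLaw φ' q) := by
    unfold NoiseModel.profileLaw; infer_instance
  set bad : Fin ℓ → Set (Fin q.size → Ranking M) := fun j =>
    {v | (q.size : ℕ) * η ≤ |∑ i, (G j).score (v i) -
      ∑ i, ∫ s, (G j).score s ∂(S.rankingLaw φ' (q.vote i)).toMeasure|} with hbad
  have hbound : ∀ j, (S.profileLaw φ' q).real (bad j) ≤ C ^ 2 / η ^ 2 / (q.size : ℕ) := by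
    intro j
    have := pi_real_abs_sum_sub_ge_le
      (fun i => (S.rankingLaw φ' (q.vote i)).toMeasure) (G j).score hη (fun y => hC (j, y))
    rwa [Fintype.card_fin] at this
  have hgood : (⋃ j, bad j)ᶜ ⊆ {v | ¬ Resolvability R ⟨q.size, v⟩} := by
    intro v hv
    simp only [hbad, Set.mem_compl_iff, Set.mem_iUnion, Set.mem_ofPred_eq, not_exists,
      not_le] at hv
    have hside : R ⟨q.size, v⟩ = R p := by
      refine hG _ _ fun j => (G j).side_histogram_eq_of_abs_sub_lt p ⟨q.size, v⟩ (hη2 j) ?_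
      have hsum : ∑ i, (G j).score (q.vote i) =
          (q.size : ℕ) * ((∑ i, (G j).score (p.vote i)) / (p.size : ℕ)) := by
        have hn : ((p.size : ℕ) : ℝ) ≠ 0 := by exact_mod_cast p.size.pos.ne'
        rw [hsize, hq, p.sum_copies]
        field_simp
      have hmean : |∑ i, ∫ s, (G j).score s ∂(S.rankingLaw φ' (q.vote i)).toMeasure -
          ∑ i, (G j).score (q.vote i)| ≤ (q.size : ℕ) * η := by
        rw [← Finset.sum_sub_distrib]
        refine (Finset.abs_sum_le_sum_abs _ _).trans ?_
        refine (Finset.sum_le_sum fun i _ => (hφη φ' hφ' j (q.vote i)).le).trans ?_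
        simp
      rw [← hsum]
      calc _ ≤ _ := abs_sub_le _
            (∑ i, ∫ s, (G j).score s ∂(S.rankingLaw φ' (q.vote i)).toMeasure) _
        _ < (q.size : ℕ) * η + (q.size : ℕ) * η := add_lt_add_of_lt_of_le (hv j) hmean
        _ = _ := by ring
    rw [Set.mem_ofPred_eq, Resolvability, hside]
    exact hcard
  have hunion : (S.profileLaw φ' q).real (⋃ j, bad j) ≤
      ℓ * (C ^ 2 / η ^ 2 / (q.size : ℕ)) := by
    refine (measureReal_iUnion_fintype_le _).trans ?_
    refine (Finset.sum_le_sum fun j _ => hbound j).trans ?_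
    simp
  calc 1 - ℓ * (C ^ 2 / η ^ 2 / ((z * p.size : ℕ) : ℝ))
      = 1 - ℓ * (C ^ 2 / η ^ 2 / (q.size : ℕ)) := by rw [hsize]; push_cast; rfl
    _ ≤ 1 - (S.profileLaw φ' q).real (⋃ j, bad j) := by linarith
    _ = (S.profileLaw φ' q).real (⋃ j, bad j)ᶜ := (probReal_compl_eq_one_sub .of_discrete).symm
    _ ≤ _ := measureReal_mono hgood

end Resolvability

end SmoothedVoting

theorem mainTheorem5 {M : Type*} [Fintype M] [DecidableEq M]
    (S : SmoothedVoting.NoiseModel (Fintype.card M))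
    (last : SmoothedVoting.Ranking M) (R : SmoothedVoting.VotingRule M) (ℓ : ℕ)
    (G : Fin ℓ → SmoothedVoting.AffineHyperplane {r : SmoothedVoting.Ranking M // r ≠ last})
    (hR : SmoothedVoting.IsHyperplaneRule last G R) :
    (SmoothedVoting.IsDecisive last G R →
      SmoothedVoting.SmoothedSatisfied S (SmoothedVoting.Resolvability R)) ∧
    (¬ SmoothedVoting.IsDecisive last G R →
      SmoothedVoting.SmoothedViolated S (SmoothedVoting.Resolvability R)) :=
  ⟨SmoothedVoting.smoothedSatisfied_resolvability S,
    SmoothedVoting.smoothedViolated_resolvability S hR⟩
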